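/- Let $\mathcal H$ be a complex Hilbert space and $k\in\mathbb N$. Let $\mathcal H^{\otimes k}$ be the $k$-fold Hilbert space tensor power, $U_\pi$ ($\pi\in S_k$) the permutation operators on it, $P_+=\frac1{k!}\sum_{\pi\in S_k}U_\pi$ and $P_-=\frac1{k!}\sum_{\pi\in S_k}\operatorname{sign}(\pi)U_\pi$, and put $\mathcal H^{\vee k}=P_+\mathcal H^{\otimes k}$, $\mathcal H^{\wedge k}=P_-\mathcal H^{\otimes k}$ and $\eta_1\wedge\dots\wedge\eta_k=\sqrt{k!}\,P_-(\eta_1\otimes\dots\otimes\eta_k)$. Let $$V^{\otimes k}=\{\eta_1\otimes\dots\otimes\eta_k:\ \eta_i\in\mathcal H,\ \|\eta_i\|=1\},\qquad V^{\vee k}=\{\eta\otimes\dots\otimes\eta:\ \eta\in\mathcal H,\ \|\eta\|=1\}\subset\mathcal H^{\vee k},$$ $$V^{\wedge k}=\{\eta_1\wedge\dots\wedge\eta_k:\ \eta_i\in\mathcal H,\ \|\eta_1\wedge\dots\wedge\eta_k\|=1\}\subset\mathcal H^{\wedge k}.$$ For vectors $\xi,\eta$ of a Hilbert space $E$ let $\omega_{\xi,\eta}(x)=\langle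 x\xi,\eta\rangle$ for $x\in\mathcal B(E)$ (scalar product linear in the first argument), and $\omega_\xi=\omega_{\xi,\xi}$. For $\ast\in\{\otimes,\vee,\wedge\}$ let $K^{\ast k}$ be the norm-closed convex hull of $\{\omega_{\xi,\eta}:\ \xi,\eta\in V^{\ast k}\}$ in the normal functionals on $\mathcal B(\mathcal H^{\ast k})$, and let $q_{K}(\psi)=\inf\{\alpha\ge 0:\ \psi\in\alpha K\}\in[0,\infty]$, with $\inf\emptyset=\infty$. A normal state on $\mathcal B(\mathcal H^{\vee k})$ (respectively $\mathcal B(\mathcal H^{\wedge k})$) is called bosonic (respectively fermionic) separable if it lies in the norm-closed convex hull of $\{\omega_\xi:\ \xi\in V^{\vee k}\}$ (respectively $\{\omega_\xi:\ \xi\in V^{\wedge k}\}$). Here a state is a positive linear functional of norm one, and it is normal if it has the form $x\mapsto\operatorname{tr}(\Phi x)$ with $\Phi$ trace class. 1. For every normal state $\varphi_+$ on $\mathcal B(\mathcal H^{\vee k})$ we have $q_{K^{\vee k}}(\varphi_+)\ge 1$, and $q_{K^{\vee k}}(\varphi_+)=1$ if and only if $\varphi_+$ is bosonic separable. 2. For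 every normal state $\varphi_-$ on $\mathcal B(\mathcal H^{\wedge k})$ we have $q_{K^{\wedge k}}(\varphi_-)\ge 1$, and $q_{K^{\wedge k}}(\varphi_-)=1$ if and only if $\varphi_-$ is fermionic separable. 3. For every normal state $\varphi_-$ on $\mathcal B(\mathcal H^{\wedge k})$, regarded as the functional $x\mapsto\varphi_-(P_-xP_-|_{\mathcal H^{\wedge k}})$ on $\mathcal B(\mathcal H^{\otimes k})$, we have $$q_{K^{\wedge k}}(\varphi_-)=\frac1{k!}\,q_{K^{\otimes k}}(\varphi_-).$$ In particular $q_{K^{\otimes k}}(\varphi_-)\ge k!$, with $q_{K^{\otimes k}}(\varphi_-)=k!$ if and only if $\varphi_-$ is fermionic separable. -/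

import Mathlib

open scoped ComplexOrder ENNReal NNReal

noncomputable section

/-! ### The Hilbert space tensor power -/

section TensorPower

variable (H : Type*) [NormedAddCommGroup H] [InnerProductSpace ℂ H] (k : ℕ)

/-- The algebraic `k`-fold tensor power of `H`. (A type synonym: `PiTensorProduct` already carries
the projective seminorm, whereas here the inner product seminorm is wanted.) -/
def AlgTensorPower : Type _ := PiTensorProduct ℂ (fun _ : Fin k => H)

instance : AddCommGroup (AlgTensorPower H k) :=
  inferInstanceAs (AddCommGroup (PiTensorProduct ℂ (fun _ : Fin k => H)))

instance : Module ℂ (AlgTensorPower H k) :=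
  inferInstanceAs (Module ℂ (PiTensorProduct ℂ (fun _ : Fin k => H)))

namespace AlgTensorPower

variable {H k}

/-- The elementary tensor `f₁ ⊗ ⋯ ⊗ fₖ`, as a multilinear map. -/
def tprod : MultilinearMap ℂ (fun _ : Fin k => H) (AlgTensorPower H k) :=
  PiTensorProduct.tprod ℂ

/-- The linear map induced by a multilinear map. -/
def lift {F : Type*} [AddCommGroup F] [Module ℂ F]
    (m : MultilinearMap ℂ (fun _ : Fin k => H) F) : AlgTensorPower H k →ₗ[ℂ] F :=
  PiTensorProduct.lift m

theorem lift_tprod {F : Type*} [AddCommGroup F] [Module ℂ F]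
    (m : MultilinearMap ℂ (fun _ : Fin k => H) F) (f : Fin k → H) : lift m (tprod f) = m f :=
  PiTensorProduct.lift.tprod f

theorem ext_tprod {F : Type*} [AddCommGroup F] [Module ℂ F] {u v : AlgTensorPower H k →ₗ[ℂ] F}
    (h : ∀ f, u (tprod f) = v (tprod f)) : u = v :=
  PiTensorProduct.ext (MultilinearMap.ext h)

theorem span_tprod : Submodule.span ℂ (Set.range (tprod : _ → AlgTensorPower H k)) = ⊤ :=
  PiTensorProduct.span_tprod_eq_top

/-- The linear functional `g₁ ⊗ ⋯ ⊗ gₖ ↦ ∏ᵢ ⟪fᵢ, gᵢ⟫`. -/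
def innerLeft (f : Fin k → H) : AlgTensorPower H k →ₗ[ℂ] ℂ :=
  lift ((MultilinearMap.mkPiAlgebra ℂ (Fin k) ℂ).compLinearMap fun i => innerₛₗ ℂ (f i))

theorem innerLeft_tprod (f g : Fin k → H) :
    innerLeft f (tprod g) = ∏ i, inner ℂ (f i) (g i) := by
  simp [innerLeft, lift_tprod]

theorem star_innerLeft_tprod (f g : Fin k → H) :
    star (innerLeft f (tprod g)) = innerLeft g (tprod f) := by
  simp [innerLeft_tprod]

/-- For fixed `y`, the multilinear map `f ↦ conj ⟪f₁ ⊗ ⋯ ⊗ fₖ, y⟫`. -/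
def innerRight (y : AlgTensorPower H k) : MultilinearMap ℂ (fun _ : Fin k => H) ℂ where
  toFun f := star (innerLeft f y)
  map_update_add' f i a b := by
    rw [← star_add, ← LinearMap.add_apply]
    congr 2
    refine ext_tprod fun g => ?_
    rw [LinearMap.add_apply, ← star_innerLeft_tprod g, ← star_innerLeft_tprod g,
      ← star_innerLeft_tprod g, MultilinearMap.map_update_add, map_add, star_add]
  map_update_smul' f i c a := by
    rw [smul_eq_mul, ← star_star c, ← star_mul', ← smul_eq_mul, ← LinearMap.smul_apply]
    congr 2
    refine ext_tprod fun g => ?_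
    rw [LinearMap.smul_apply, ← star_innerLeft_tprod g, ← star_innerLeft_tprod g,
      MultilinearMap.map_update_smul, map_smul, smul_eq_mul, smul_eq_mul, star_mul', star_star]

/-- The inner product with `⟪f₁ ⊗ ⋯ ⊗ fₖ, g₁ ⊗ ⋯ ⊗ gₖ⟫ = ∏ᵢ ⟪fᵢ, gᵢ⟫`,
conjugate linear in the first argument. -/
instance : Inner ℂ (AlgTensorPower H k) where
  inner x y := star (lift (innerRight y) x)

theorem inner_tprod_left (f : Fin k → H) (y : AlgTensorPower H k) :
    inner ℂ (tprod f) y = innerLeft f y := by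
  change star (lift (innerRight y) (tprod f)) = _
  rw [lift_tprod]
  exact star_star _

theorem inner_tprod_tprod (f g : Fin k → H) :
    inner ℂ (tprod f : AlgTensorPower H k) (tprod g) = ∏ i, inner ℂ (f i) (g i) := by
  rw [inner_tprod_left, innerLeft_tprod]

theorem inner_add_left' (x y z : AlgTensorPower H k) :
    inner ℂ (x + y) z = inner ℂ x z + inner ℂ y z := by
  change star (lift _ _) = star (lift _ _) + star (lift _ _)
  rw [map_add, star_add]

theorem inner_smul_left' (c : ℂ) (x y : AlgTensorPower H k) :
    inner ℂ (c • x) y = star c * inner ℂ x y := by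
  change star (lift _ _) = star c * star (lift _ _)
  rw [map_smul, smul_eq_mul, star_mul']

theorem induction_tprod {p : AlgTensorPower H k → Prop} (x : AlgTensorPower H k)
    (h : ∀ (c : ℂ) f, p (c • tprod f)) (ha : ∀ x y, p x → p y → p (x + y)) : p x :=
  PiTensorProduct.induction_on x h ha

theorem star_inner (x y : AlgTensorPower H k) : star (inner ℂ y x) = inner ℂ x y := by
  induction x using induction_tprod with
  | h c f =>
    rw [inner_smul_left', inner_tprod_left]
    induction y using induction_tprod with
    | h d g =>
      rw [inner_smul_left', inner_tprod_left, map_smul, map_smul, ← star_innerLeft_tprod f g]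
      simp only [smul_eq_mul, star_mul', star_star]
      ring
    | ha y z hy hz => rw [inner_add_left', map_add, mul_add, star_add, hy, hz]
  | ha x z hx hz =>
    rw [inner_add_left', ← hx, ← hz, ← star_add]
    change star (star (lift _ _)) = star (star (lift _ _) + star (lift _ _))
    rw [← star_add]
    congr 2
    have : innerRight (x + z) = innerRight x + innerRight z := by
      ext f
      change star (innerLeft f _) = star (innerLeft f _) + star (innerLeft f _)
      rw [map_add, star_add]
    rw [this]
    exact congrArg (fun l => l y) (map_add PiTensorProduct.lift (innerRight x) (innerRight z))

theorem posSemidef_prod_gram {n : Type*} [Fintype n] (v : n → Fin k → H) (s : Finset (Fin k)) :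
    (Matrix.of fun a b => ∏ i ∈ s, inner ℂ (v a i) (v b i)).PosSemidef := by
  classical
  induction s using Finset.induction_on with
  | empty =>
    have h := Matrix.posSemidef_gram ℂ (fun _ : n => (1 : ℂ))
    have e : (Matrix.of fun a b => ∏ i ∈ (∅ : Finset (Fin k)), inner ℂ (v a i) (v b i)) =
        Matrix.gram ℂ (fun _ : n => (1 : ℂ)) := by
      ext a b
      simp [Matrix.gram_apply]
    rw [e]
    exact h
  | insert i s hi ih =>
    have h := (Matrix.posSemidef_gram ℂ (fun a => v a i)).hadamard ih
    have e : (Matrix.of fun a b => ∏ i ∈ insert i s, inner ℂ (v a i) (v b i)) =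
        (Matrix.gram ℂ fun a => v a i).hadamard
          (Matrix.of fun a b => ∏ i ∈ s, inner ℂ (v a i) (v b i)) := by
      ext a b
      simp [Matrix.gram_apply, Finset.prod_insert hi]
    rw [e]
    exact h

theorem re_inner_self_nonneg (x : AlgTensorPower H k) : 0 ≤ (inner ℂ x x : ℂ).re := by
  have hx : x ∈ Submodule.span ℂ (Set.range (tprod : _ → AlgTensorPower H k)) := by
    rw [span_tprod]; trivial
  obtain ⟨c, rfl⟩ := (Finsupp.mem_span_range_iff_exists_finsupp).1 hx
  have h := (posSemidef_prod_gram (fun a : c.support => (a : Fin k → H))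
    Finset.univ).dotProduct_mulVec_nonneg (fun a => c a)
  have e : (inner ℂ (c.sum fun i a => a • (tprod i : AlgTensorPower H k))
      (c.sum fun i a => a • tprod i) : ℂ) = star (fun a : c.support => c a) ⬝ᵥ
      (Matrix.of fun a b : c.support => ∏ i, inner ℂ ((a : Fin k → H) i) ((b : Fin k → H) i)).mulVec
        (fun a => c a) := by
    set y := c.sum fun i a => a • (tprod i : AlgTensorPower H k) with hy
    have h1 : ∀ z, (inner ℂ y z : ℂ) = ∑ a ∈ c.support, star (c a) * innerLeft a z := by
      intro z
      change star (lift (innerRight z) y) = _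
      rw [hy, Finsupp.sum, map_sum, star_sum]
      refine Finset.sum_congr rfl fun a _ => ?_
      rw [map_smul, smul_eq_mul, star_mul', ← inner_tprod_left]
      rfl
    rw [h1, ← Finset.sum_coe_sort]
    refine Finset.sum_congr rfl fun a _ => ?_
    rw [Pi.star_apply, hy, Finsupp.sum, map_sum, ← Finset.sum_coe_sort]
    congr 1
    refine Finset.sum_congr rfl fun b _ => ?_
    rw [map_smul, smul_eq_mul, innerLeft_tprod, mul_comm]
    rfl
  rw [e]
  exact (Complex.le_def.1 h).1

instance : PreInnerProductSpace.Core ℂ (AlgTensorPower H k) where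
  conj_inner_symm x y := star_inner x y
  re_inner_nonneg := re_inner_self_nonneg
  add_left := inner_add_left'
  smul_left x y c := inner_smul_left' c x y

instance : SeminormedAddCommGroup (AlgTensorPower H k) :=
  InnerProductSpace.Core.toSeminormedAddCommGroup (𝕜 := ℂ)

instance : InnerProductSpace ℂ (AlgTensorPower H k) :=
  InnerProductSpace.ofCore inferInstance

/-- The operator `f₁ ⊗ ⋯ ⊗ fₖ ↦ f_{π⁻¹(1)} ⊗ ⋯ ⊗ f_{π⁻¹(k)}` on the algebraic tensor power. -/
def perm (π : Equiv.Perm (Fin k)) : AlgTensorPower H k →ₗ[ℂ] AlgTensorPower H k :=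
  lift (tprod.domDomCongr π.symm)

theorem perm_tprod (π : Equiv.Perm (Fin k)) (f : Fin k → H) :
    perm π (tprod f) = tprod fun i => f (π.symm i) :=
  lift_tprod _ f

theorem inner_perm_perm (π : Equiv.Perm (Fin k)) (x y : AlgTensorPower H k) :
    inner ℂ (perm π x) (perm π y) = inner ℂ x y := by
  induction x using induction_tprod with
  | h c f =>
    induction y using induction_tprod with
    | h d g =>
      simp only [map_smul, inner_smul_left, inner_smul_right, perm_tprod, inner_tprod_tprod]
      rw [Equiv.prod_comp π.symm fun i => (inner ℂ (f i) (g i) : ℂ)]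
    | ha y z hy hz => rw [map_add, inner_add_right, inner_add_right, hy, hz]
  | ha x z hx hz => rw [map_add, inner_add_left, inner_add_left, hx, hz]

/-- `perm π` as an isometry. -/
def permₗᵢ (π : Equiv.Perm (Fin k)) : AlgTensorPower H k →ₗᵢ[ℂ] AlgTensorPower H k :=
  ⟨perm π, fun x => by
    rw [norm_eq_sqrt_re_inner (𝕜 := ℂ), norm_eq_sqrt_re_inner (𝕜 := ℂ), inner_perm_perm]⟩

end AlgTensorPower

/-- The `k`-fold Hilbert space tensor power `H^{⊗k}`: the completion of the algebraic one. -/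
abbrev HilbertTensorPower : Type _ := UniformSpace.Completion (AlgTensorPower H k)

variable {H k}

/-- The product vector `η₁ ⊗ ⋯ ⊗ ηₖ`. -/
def productVector (η : Fin k → H) : HilbertTensorPower H k :=
  ((AlgTensorPower.tprod η : AlgTensorPower H k) : HilbertTensorPower H k)

variable (H) in
/-- The permutation operator `U_π` on `H^{⊗k}`. -/
def permOp (π : Equiv.Perm (Fin k)) : HilbertTensorPower H k →L[ℂ] HilbertTensorPower H k :=
  (AlgTensorPower.permₗᵢ π).toContinuousLinearMap.completion

theorem permOp_productVector (π : Equiv.Perm (Fin k)) (η : Fin k → H) :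
    permOp H π (productVector η) = productVector fun i => η (π.symm i) := by
  rw [permOp, productVector, ContinuousLinearMap.completion_apply_coe]
  exact congrArg _ (AlgTensorPower.perm_tprod π η)

theorem permOp_mul (π σ : Equiv.Perm (Fin k)) : permOp H (π * σ) = permOp H π * permOp H σ := by
  refine ContinuousLinearMap.ext fun x => ?_
  induction x using UniformSpace.Completion.induction_on with
  | hp => exact isClosed_eq (ContinuousLinearMap.continuous _) (ContinuousLinearMap.continuous _)
  | ih x =>
    induction x using AlgTensorPower.induction_tprod with
    | h c f =>
      rw [UniformSpace.Completion.coe_smul, map_smul, map_smul]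
      congr 1
      change permOp H (π * σ) (productVector f) = permOp H π (permOp H σ (productVector f))
      rw [permOp_productVector, permOp_productVector, permOp_productVector]
      rfl
    | ha x y hx hy => rw [UniformSpace.Completion.coe_add, map_add, map_add, hx, hy]

variable (H k) in
/-- `P₊ = (1/k!) ∑_π U_π`. -/
def symProj : HilbertTensorPower H k →L[ℂ] HilbertTensorPower H k :=
  ((k.factorial : ℂ)⁻¹) • ∑ π : Equiv.Perm (Fin k), permOp H π

variable (H k) in
/-- `P₋ = (1/k!) ∑_π sign(π) U_π`. -/
def antisymProj : HilbertTensorPower H k →L[ℂ] HilbertTensorPower H k :=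
  ((k.factorial : ℂ)⁻¹) • ∑ π : Equiv.Perm (Fin k), ((Equiv.Perm.sign π : ℤ) : ℂ) • permOp H π

theorem permOp_mul_symProj (σ : Equiv.Perm (Fin k)) : permOp H σ * symProj H k = symProj H k := by
  rw [symProj, mul_smul_comm, Finset.mul_sum]
  congr 1
  simp_rw [← permOp_mul]
  exact Equiv.sum_comp (Equiv.mulLeft σ) fun π => permOp H π

theorem permOp_mul_antisymProj (σ : Equiv.Perm (Fin k)) :
    permOp H σ * antisymProj H k = ((Equiv.Perm.sign σ : ℤ) : ℂ) • antisymProj H k := by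
  rw [antisymProj, mul_smul_comm, Finset.mul_sum, smul_comm]
  congr 1
  rw [← Equiv.sum_comp (Equiv.mulLeft σ) fun π => ((Equiv.Perm.sign π : ℤ) : ℂ) • permOp H π,
    Finset.smul_sum]
  refine Finset.sum_congr rfl fun π _ => ?_
  rw [Equiv.coe_mulLeft, permOp_mul, mul_smul_comm, smul_smul, ← Int.cast_mul, ← Units.val_mul,
    map_mul, ← mul_assoc, Int.units_mul_self, one_mul]

theorem symProj_idem : symProj H k * symProj H k = symProj H k := by
  conv_lhs => enter [1]; rw [symProj]
  rw [smul_mul_assoc, Finset.sum_mul]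
  simp_rw [permOp_mul_symProj]
  rw [Finset.sum_const, Finset.card_univ, Fintype.card_perm, Fintype.card_fin,
    ← Nat.cast_smul_eq_nsmul ℂ, smul_smul, inv_mul_cancel₀ (by positivity), one_smul]

theorem antisymProj_idem : antisymProj H k * antisymProj H k = antisymProj H k := by
  conv_lhs => enter [1]; rw [antisymProj]
  rw [smul_mul_assoc, Finset.sum_mul]
  simp_rw [smul_mul_assoc, permOp_mul_antisymProj, smul_smul, ← Int.cast_mul, ← Units.val_mul,
    Int.units_mul_self, Units.val_one, Int.cast_one, one_smul]
  rw [Finset.sum_const, Finset.card_univ, Fintype.card_perm, Fintype.card_fin,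
    ← Nat.cast_smul_eq_nsmul ℂ, smul_smul, inv_mul_cancel₀ (by positivity), one_smul]

theorem isClosed_range_of_idem {E : Type*} [NormedAddCommGroup E] [NormedSpace ℂ E]
    {P : E →L[ℂ] E} (h : P * P = P) : IsClosed (LinearMap.range P.toLinearMap : Set E) := by
  have e : (LinearMap.range P.toLinearMap : Set E) = {x | P x = x} := by
    ext x
    constructor
    · rintro ⟨y, rfl⟩
      exact congrArg (fun T : E →L[ℂ] E => T y) h
    · exact fun hx => ⟨x, hx⟩
  rw [e]
  exact isClosed_eq P.continuous continuous_id

variable (H k) in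
/-- The bosonic subspace `H^{∨k} = P₊ H^{⊗k}`. -/
def bosonicSpace : Submodule ℂ (HilbertTensorPower H k) :=
  LinearMap.range (symProj H k).toLinearMap

variable (H k) in
/-- The fermionic subspace `H^{∧k} = P₋ H^{⊗k}`. -/
def fermionicSpace : Submodule ℂ (HilbertTensorPower H k) :=
  LinearMap.range (antisymProj H k).toLinearMap

instance : CompleteSpace (bosonicSpace H k) :=
  (isClosed_range_of_idem symProj_idem).completeSpace_coe

instance : CompleteSpace (fermionicSpace H k) :=
  (isClosed_range_of_idem antisymProj_idem).completeSpace_coe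

/-- The antisymmetric product `η₁ ∧ ⋯ ∧ ηₖ = √(k!) P₋ (η₁ ⊗ ⋯ ⊗ ηₖ)`. -/
def wedge (η : Fin k → H) : HilbertTensorPower H k :=
  ((Real.sqrt k.factorial : ℝ) : ℂ) • antisymProj H k (productVector η)

variable (H k) in
/-- `V^{⊗k}`: the unit product vectors. -/
def productVectors : Set (HilbertTensorPower H k) :=
  {ξ | ∃ η : Fin k → H, (∀ i, ‖η i‖ = 1) ∧ ξ = productVector η}

variable (H k) in
/-- `V^{∨k}`: the vectors `η ⊗ ⋯ ⊗ η` with `‖η‖ = 1`, as elements of `H^{∨k}`. -/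
def bosonicProductVectors : Set (bosonicSpace H k) :=
  {ξ | ∃ η : H, ‖η‖ = 1 ∧ (ξ : HilbertTensorPower H k) = productVector fun _ => η}

variable (H k) in
/-- `V^{∧k}`: the unit vectors of the form `η₁ ∧ ⋯ ∧ ηₖ`, as elements of `H^{∧k}`. -/
def fermionicProductVectors : Set (fermionicSpace H k) :=
  {ξ | ‖ξ‖ = 1 ∧ ∃ η : Fin k → H, (ξ : HilbertTensorPower H k) = wedge η}

end TensorPower

/-! ### Functionals on `B(E)` -/

section Functionals

variable {E : Type*} [NormedAddCommGroup E] [InnerProductSpace ℂ E]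

/-- The vector functional `ω_{ξ,η}(x) = ⟨xξ, η⟩`, where `⟨·,·⟩` is linear in its first argument
(so `⟨xξ, η⟩` is `inner ℂ η (x ξ)` in Mathlib's convention). -/
def vectorFunctional (ξ η : E) : StrongDual ℂ (E →L[ℂ] E) :=
  (innerSL ℂ η).comp (ContinuousLinearMap.apply ℂ E ξ)

theorem vectorFunctional_apply (ξ η : E) (x : E →L[ℂ] E) :
    vectorFunctional ξ η x = inner ℂ η (x ξ) := rfl

/-- The norm-closed convex hull of the functionals `ω_{ξ,η}` with `ξ, η ∈ V`. (The normal
functionals form a norm-closed subspace of the dual of `B(E)`, so it does not matter whether the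
closure is taken in that subspace or in the whole dual.) -/
def vectorHull (V : Set E) : Set (StrongDual ℂ (E →L[ℂ] E)) :=
  closure (convexHull ℝ {ψ | ∃ ξ ∈ V, ∃ η ∈ V, ψ = vectorFunctional ξ η})

/-- The norm-closed convex hull of the functionals `ω_ξ = ω_{ξ,ξ}` with `ξ ∈ V`. -/
def separableHull (V : Set E) : Set (StrongDual ℂ (E →L[ℂ] E)) :=
  closure (convexHull ℝ {ψ | ∃ ξ ∈ V, ψ = vectorFunctional ξ ξ})

/-- The Minkowski functional `q_K(ψ) = inf {α ≥ 0 : ψ ∈ αK}`, with `inf ∅ = ∞`. -/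
def minkowski (K : Set (StrongDual ℂ (E →L[ℂ] E))) (ψ : StrongDual ℂ (E →L[ℂ] E)) : ℝ≥0∞ :=
  ⨅ (α : ℝ≥0) (_ : ∃ κ ∈ K, ψ = (α : ℂ) • κ), (α : ℝ≥0∞)

variable [CompleteSpace E]

/-- A Hilbert basis of `E` (an arbitrary choice; the trace below does not depend on it). -/
def someHilbertBasis (E : Type*) [NormedAddCommGroup E] [InnerProductSpace ℂ E] [CompleteSpace E] :
    HilbertBasis (exists_hilbertBasis ℂ E).choose ℂ E :=
  (exists_hilbertBasis ℂ E).choose_spec.choose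

/-- `T` is trace class: `∑ᵢ ⟨|T| eᵢ, eᵢ⟩ < ∞`, where `|T| = √(T* T)`. -/
def IsTraceClass (T : E →L[ℂ] E) : Prop :=
  Summable fun i => (inner ℂ (someHilbertBasis E i) (CFC.abs T (someHilbertBasis E i)) : ℂ)

/-- The trace `∑ᵢ ⟨T eᵢ, eᵢ⟩` of a trace class operator. -/
def opTrace (T : E →L[ℂ] E) : ℂ :=
  ∑' i, inner ℂ (someHilbertBasis E i) (T (someHilbertBasis E i))

/-- `ψ` is normal: `ψ(x) = tr(Φ x)` for a trace class operator `Φ`. -/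
def IsNormal (ψ : StrongDual ℂ (E →L[ℂ] E)) : Prop :=
  ∃ T : E →L[ℂ] E, IsTraceClass T ∧ ∀ x, ψ x = opTrace (T * x)

/-- `ψ` is a normal state on `B(E)`: a normal positive linear functional of norm one. -/
structure IsNormalState (ψ : StrongDual ℂ (E →L[ℂ] E)) : Prop where
  normal : IsNormal ψ
  nonneg : ∀ x : E →L[ℂ] E, x.IsPositive → 0 ≤ ψ x
  norm_eq_one : ‖ψ‖ = 1

end Functionals

/-! ### Indistinguishable particles -/

section Particles

variable {H : Type*} [NormedAddCommGroup H] [InnerProductSpace ℂ H] {k : ℕ}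

/-- Bosonic separability of a (normal state) `ψ` on `B(H^{∨k})`. -/
def IsBosonicSeparable
    (ψ : StrongDual ℂ (bosonicSpace H k →L[ℂ] bosonicSpace H k)) : Prop :=
  ψ ∈ separableHull (bosonicProductVectors H k)

/-- Fermionic separability of a (normal state) `ψ` on `B(H^{∧k})`. -/
def IsFermionicSeparable
    (ψ : StrongDual ℂ (fermionicSpace H k →L[ℂ] fermionicSpace H k)) : Prop :=
  ψ ∈ separableHull (fermionicProductVectors H k)

variable (H k) in
/-- `P₋` as a map onto `H^{∧k}`. -/
def antisymProjRestrict : HilbertTensorPower H k →L[ℂ] fermionicSpace H k :=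
  (antisymProj H k).codRestrict (fermionicSpace H k) fun x => ⟨x, rfl⟩

variable (H k) in
/-- The compression `x ↦ P₋ x P₋`, with `P₋ B(H^{⊗k}) P₋` identified with `B(H^{∧k})`. -/
def compress : (HilbertTensorPower H k →L[ℂ] HilbertTensorPower H k) →L[ℂ]
    (fermionicSpace H k →L[ℂ] fermionicSpace H k) :=
  ((antisymProjRestrict H k).postcomp (fermionicSpace H k)).comp
    ((fermionicSpace H k).subtypeL.precomp (HilbertTensorPower H k))

theorem compress_apply (x : HilbertTensorPower H k →L[ℂ] HilbertTensorPower H k)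
    (ξ : fermionicSpace H k) :
    (compress H k x ξ : HilbertTensorPower H k) = antisymProj H k (x ξ) := rfl

/-- A functional on `B(H^{∧k})` viewed as a functional on `B(H^{⊗k})`: `x ↦ ψ(P₋ x P₋)`. -/
def viewOnTensorPower (ψ : StrongDual ℂ (fermionicSpace H k →L[ℂ] fermionicSpace H k)) :
    StrongDual ℂ (HilbertTensorPower H k →L[ℂ] HilbertTensorPower H k) :=
  ψ.comp (compress H k)

end Particles

end

/-! ### Convex hulls of vector functionals -/

section Hulls

set_option maxSynthPendingDepth 3

variable {E : Type*} [NormedAddCommGroup E] [InnerProductSpace ℂ E]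

/-! Vector functionals of unit vectors have norm at most one, so each hull lies in the unit ball and
`q ≥ 1` on states. If `q = 1`, closedness puts the state `φ` itself in the hull. Positivity and norm
one give `φ(1) = 1`, the largest value possible, and this forces the generators towards the
diagonal: `‖ω_{ξ,η} - ω_ξ‖² ≤ ‖η - ξ‖² = 2 - 2 Re ω_{ξ,η}(1)`. By convexity of the square the same
estimate holds for convex combinations (`exists_mem_convexHull_norm_sub_sq_le`), so approximants of
`φ` can be replaced by separable ones with the same limit.

The factor `k!` comes from two opposite computations. A unit wedge is `1/√k!` times a sum of `k!`
signed unit product vectors, so a functional of two such wedges is `k!` times an average of `k!²`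
elements of `K^{⊗k}`. Conversely `P₋` sends a product vector to `1/√k!` times a wedge, which for
unit factors has norm at most one by Hadamard's inequality (`norm_wedge_le`). Restricting `K^{⊗k}`
to `B(H^{∧k})` therefore lands in `K^{∧k}/k!`, provided that unit wedges exist. Since restriction
undoes `viewOnTensorPower`, the two inclusions give the equality in `minkowski_viewOnTensorPower`.
-/

theorem norm_vectorFunctional_le (ξ η : E) : ‖vectorFunctional ξ η‖ ≤ ‖ξ‖ * ‖η‖ := by
  refine ContinuousLinearMap.opNorm_le_bound _ (by positivity) fun x => ?_
  rw [vectorFunctional_apply]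
  calc ‖(inner ℂ η (x ξ) : ℂ)‖ ≤ ‖η‖ * ‖x ξ‖ := norm_inner_le_norm _ _
    _ ≤ ‖η‖ * (‖x‖ * ‖ξ‖) := by gcongr; exact x.le_opNorm ξ
    _ = ‖ξ‖ * ‖η‖ * ‖x‖ := by ring

theorem vectorFunctional_sub_right (ξ η ζ : E) :
    vectorFunctional ξ η - vectorFunctional ξ ζ = vectorFunctional ξ (η - ζ) := by
  ext x
  simp [vectorFunctional_apply]

theorem vectorFunctional_smul_smul (a b : ℂ) (ξ η : E) :
    vectorFunctional (a • ξ) (b • η) = (a * star b) • vectorFunctional ξ η := by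
  ext x
  simp only [vectorFunctional_apply, map_smul, inner_smul_left, inner_smul_right,
    _root_.smul_apply, smul_eq_mul]
  change _ = a * (starRingEnd ℂ) b * _
  ring

theorem zero_vectorFunctional (η : E) : vectorFunctional (0 : E) η = 0 := by
  ext x
  simp [vectorFunctional_apply]

theorem vectorFunctional_zero (ξ : E) : vectorFunctional ξ (0 : E) = 0 := by
  ext x
  simp [vectorFunctional_apply]

theorem vectorFunctional_sum_sum {ι : Type*} (s : Finset ι) (ξ η : ι → E) :
    vectorFunctional (∑ i ∈ s, ξ i) (∑ j ∈ s, η j) =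
      ∑ p ∈ s ×ˢ s, vectorFunctional (ξ p.1) (η p.2) := by
  ext x
  simp only [vectorFunctional_apply, map_sum, sum_inner, inner_sum, sum_apply]
  exact (Finset.sum_product s s fun p => inner ℂ (η p.2) (x (ξ p.1))).symm

theorem convex_vectorHull (V : Set E) : Convex ℝ (vectorHull V) := (convex_convexHull ℝ _).closure

theorem isClosed_vectorHull (V : Set E) : IsClosed (vectorHull V) := isClosed_closure

theorem vectorFunctional_mem_vectorHull {V : Set E} {ξ η : E} (hξ : ξ ∈ V) (hη : η ∈ V) :
    vectorFunctional ξ η ∈ vectorHull V :=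
  subset_closure (subset_convexHull ℝ _ ⟨ξ, hξ, η, hη, rfl⟩)

theorem separableHull_subset_vectorHull (V : Set E) : separableHull V ⊆ vectorHull V :=
  closure_mono (convexHull_mono fun _ ⟨ξ, hξ, h⟩ => ⟨ξ, hξ, ξ, hξ, h⟩)

/-- To map `vectorHull V` into a closed convex set it suffices to map its generators there. -/
theorem map_vectorHull {F : Type*} [NormedAddCommGroup F] [NormedSpace ℂ F] {V : Set E}
    (L : StrongDual ℂ (E →L[ℂ] E) →L[ℂ] F) {C : Set F} (hC : Convex ℝ C) (hC' : IsClosed C)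
    (h : ∀ ξ ∈ V, ∀ η ∈ V, L (vectorFunctional ξ η) ∈ C)
    {κ : StrongDual ℂ (E →L[ℂ] E)} (hκ : κ ∈ vectorHull V) : L κ ∈ C := by
  have hsub : vectorHull V ⊆ L ⁻¹' C := by
    refine closure_minimal (convexHull_min ?_ ?_) (hC'.preimage L.continuous)
    · rintro _ ⟨ξ, hξ, η, hη, rfl⟩
      exact h ξ hξ η hη
    · exact hC.linear_preimage (L.restrictScalars ℝ).toLinearMap
  exact hsub hκ

theorem comp_vectorHull {F : Type*} [NormedAddCommGroup F] [InnerProductSpace ℂ F] {V : Set E}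
    (T : (F →L[ℂ] F) →L[ℂ] (E →L[ℂ] E)) (c : ℂ) {C : Set (StrongDual ℂ (F →L[ℂ] F))}
    (hC : Convex ℝ C) (hC' : IsClosed C)
    (h : ∀ ξ ∈ V, ∀ η ∈ V, c • (vectorFunctional ξ η).comp T ∈ C)
    {κ : StrongDual ℂ (E →L[ℂ] E)} (hκ : κ ∈ vectorHull V) : c • κ.comp T ∈ C :=
  map_vectorHull (c • ContinuousLinearMap.precomp ℂ T) hC hC' h hκ

/-- Expanding both sums gives one generator for each pair of indices, so the normalised functional
is their plain average. It is applied to the signed product vectors that make up a wedge. -/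
theorem vectorFunctional_sum_mem_vectorHull {ι : Type*} [Fintype ι] [Nonempty ι] {V : Set E}
    {ξ η : ι → E} (hξ : ∀ i, ξ i ∈ V) (hη : ∀ i, η i ∈ V) :
    ((Fintype.card ι : ℂ)⁻¹ * (Fintype.card ι : ℂ)⁻¹) •
      vectorFunctional (∑ i, ξ i) (∑ i, η i) ∈ vectorHull V := by
  have hsum : ((Fintype.card ι : ℂ)⁻¹ * (Fintype.card ι : ℂ)⁻¹) •
      vectorFunctional (∑ i, ξ i) (∑ i, η i) = ∑ p ∈ (Finset.univ ×ˢ Finset.univ : Finset (ι × ι)),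
        ((Fintype.card ι : ℝ)⁻¹ * (Fintype.card ι : ℝ)⁻¹) •
          vectorFunctional (ξ p.1) (η p.2) := by
    rw [vectorFunctional_sum_sum, Finset.smul_sum]
    refine Finset.sum_congr rfl fun p _ => ?_
    rw [← Complex.coe_smul]
    push_cast
    rfl
  rw [hsum]
  refine (convex_vectorHull V).sum_mem (fun p _ => by positivity) ?_
    fun p _ => vectorFunctional_mem_vectorHull (hξ p.1) (hη p.2)
  have hk : (Fintype.card ι : ℝ) ≠ 0 := by exact_mod_cast Fintype.card_ne_zero
  rw [Finset.sum_const, Finset.card_product, Finset.card_univ, nsmul_eq_mul]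
  push_cast
  field_simp

theorem zero_mem_vectorHull {V : Set E} {ξ : E} (hξ : ξ ∈ V) (hneg : -ξ ∈ V) :
    0 ∈ vectorHull V := by
  have h := convex_vectorHull V (vectorFunctional_mem_vectorHull hξ hξ)
    (vectorFunctional_mem_vectorHull hneg hξ) (a := 1 / 2) (b := 1 / 2) (by norm_num) (by norm_num)
    (by norm_num)
  have e : vectorFunctional (-ξ) ξ = - vectorFunctional ξ ξ := by
    simpa using vectorFunctional_smul_smul (-1) 1 ξ ξ
  rwa [e, smul_neg, add_neg_cancel] at h

theorem vectorFunctional_smul_smul_mem_vectorHull {V : Set E} (h0 : 0 ∈ vectorHull V) {ξ η : E}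
    (hξ : ξ ∈ V) (hη : η ∈ V) {s t : ℝ} (hs : s ∈ Set.Icc (0 : ℝ) 1) (ht : t ∈ Set.Icc (0 : ℝ) 1) :
    vectorFunctional ((s : ℂ) • ξ) ((t : ℂ) • η) ∈ vectorHull V := by
  rw [vectorFunctional_smul_smul, Complex.star_def, Complex.conj_ofReal, ← Complex.ofReal_mul,
    Complex.coe_smul]
  exact (convex_vectorHull V).smul_mem_of_zero_mem h0 (vectorFunctional_mem_vectorHull hξ hη)
    ⟨mul_nonneg hs.1 ht.1, mul_le_one₀ hs.2 ht.1 ht.2⟩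

/-! ### Norm bounds and the Minkowski functional -/

theorem norm_le_one_of_mem_vectorHull {V : Set E} (hV : ∀ ξ ∈ V, ‖ξ‖ = 1)
    {κ : StrongDual ℂ (E →L[ℂ] E)} (hκ : κ ∈ vectorHull V) : ‖κ‖ ≤ 1 := by
  have h := map_vectorHull (ContinuousLinearMap.id ℂ _) (convex_closedBall 0 1)
    Metric.isClosed_closedBall (fun ξ hξ η hη => ?_) hκ
  · simpa using h
  · simpa [hV ξ hξ, hV η hη] using norm_vectorFunctional_le ξ η

theorem one_le_minkowski_vectorHull {V : Set E} (hV : ∀ ξ ∈ V, ‖ξ‖ = 1)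
    {φ : StrongDual ℂ (E →L[ℂ] E)} (hφ : ‖φ‖ = 1) : 1 ≤ minkowski (vectorHull V) φ := by
  refine le_iInf₂ fun α ⟨κ, hκ, h⟩ => ?_
  have hα : (1 : ℝ) ≤ α := by
    have h1 := norm_le_one_of_mem_vectorHull hV hκ
    rw [← hφ, h, norm_smul, Complex.norm_real, Real.norm_of_nonneg α.coe_nonneg]
    exact mul_le_of_le_one_right α.coe_nonneg h1
  exact_mod_cast hα

/-- If a closed set has Minkowski functional `1` at `φ`, it contains `φ`. -/
theorem mem_of_minkowski_eq_one {K : Set (StrongDual ℂ (E →L[ℂ] E))} (hK : IsClosed K)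
    {φ : StrongDual ℂ (E →L[ℂ] E)} (h : minkowski K φ = 1) : φ ∈ K := by
  -- The infimum is not known to be attained, so scales in `[1, 1 + 1/(n+1))` are chosen. The lower
  -- bound also makes them invertible.
  have hex : ∀ n : ℕ, ∃ α : ℝ≥0, (1 ≤ α ∧ α < 1 + 1 / ((n : ℝ≥0) + 1)) ∧
      ∃ κ ∈ K, φ = (α : ℂ) • κ := by
    intro n
    have hlt : minkowski K φ < ((1 + 1 / ((n : ℝ≥0) + 1) : ℝ≥0) : ℝ≥0∞) := by
      rw [h]
      exact_mod_cast lt_add_of_pos_right 1 (by positivity)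
    rw [minkowski] at hlt
    simp only [iInf_lt_iff] at hlt
    obtain ⟨α, hα, hlt⟩ := hlt
    refine ⟨α, ⟨?_, by exact_mod_cast hlt⟩, hα⟩
    have : (1 : ℝ≥0∞) ≤ α := h ▸ iInf₂_le α hα
    exact_mod_cast this
  choose α hα κ hκ hφ using hex
  have hlim : Filter.Tendsto (fun n => (α n : ℝ)) Filter.atTop (nhds 1) := by
    refine tendsto_of_tendsto_of_tendsto_of_le_of_le (g := fun _ => (1 : ℝ))
      (h := fun n : ℕ => 1 + 1 / ((n : ℝ) + 1)) tendsto_const_nhds ?_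
      (fun n => by exact_mod_cast (hα n).1) (fun n => by exact_mod_cast (hα n).2.le)
    simpa using (tendsto_const_nhds (x := (1 : ℝ))).add
      (tendsto_one_div_add_atTop_nhds_zero_nat (𝕜 := ℝ))
  -- Here `κ n` is `φ` divided by `α n`, and `α n` tends to one.
  have hκlim : Filter.Tendsto κ Filter.atTop (nhds φ) := by
    have h1 : Filter.Tendsto (fun n => (((α n : ℝ)⁻¹ : ℝ) : ℂ) • φ) Filter.atTop (nhds φ) := by
      have h2 : Filter.Tendsto (fun n => (((α n : ℝ)⁻¹ : ℝ) : ℂ)) Filter.atTop (nhds 1) := by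
        have := (Complex.continuous_ofReal.tendsto _).comp (hlim.inv₀ one_ne_zero)
        simpa [Function.comp_def] using this
      simpa using h2.smul_const φ
    refine h1.congr fun n => ?_
    have hne : ((α n : ℝ) : ℂ) ≠ 0 := by
      have : (0 : ℝ≥0) < α n := one_pos.trans_le (hα n).1
      exact_mod_cast this.ne'
    conv_lhs => rw [hφ n]
    rw [smul_smul, Complex.ofReal_inv, inv_mul_cancel₀ hne, one_smul]
  exact hK.mem_of_tendsto hκlim (Filter.Eventually.of_forall hκ)

/-- A convex combination of `ω_{ξ,η}` with `ξ, η ∈ V` is close to one of `ω_ξ` as soon as its value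
at the identity is close to `1`. -/
theorem exists_mem_convexHull_norm_sub_sq_le {V : Set E} (hV : ∀ ξ ∈ V, ‖ξ‖ = 1)
    {ψ : StrongDual ℂ (E →L[ℂ] E)}
    (hψ : ψ ∈ convexHull ℝ {ψ | ∃ ξ ∈ V, ∃ η ∈ V, ψ = vectorFunctional ξ η}) :
    ∃ ψ' ∈ convexHull ℝ {ψ | ∃ ξ ∈ V, ψ = vectorFunctional ξ ξ},
      ‖ψ - ψ'‖ ^ 2 ≤ 2 - 2 * (ψ 1).re := by
  let C : Set (StrongDual ℂ (E →L[ℂ] E)) :=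
    {ψ | ∃ ψ' ∈ convexHull ℝ {ψ | ∃ ξ ∈ V, ψ = vectorFunctional ξ ξ},
      ‖ψ - ψ'‖ ^ 2 ≤ 2 - 2 * (ψ 1).re}
  suffices h : convexHull ℝ {ψ | ∃ ξ ∈ V, ∃ η ∈ V, ψ = vectorFunctional ξ η} ⊆ C from h hψ
  refine convexHull_min ?_ ?_
  · rintro _ ⟨ξ, hξ, η, hη, rfl⟩
    refine ⟨vectorFunctional ξ ξ, subset_convexHull ℝ _ ⟨ξ, hξ, rfl⟩, ?_⟩
    rw [vectorFunctional_sub_right, vectorFunctional_apply]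
    have h1 := norm_vectorFunctional_le ξ (η - ξ)
    rw [hV ξ hξ, one_mul] at h1
    have h2 := @norm_sub_sq ℂ E _ _ _ η ξ
    rw [hV ξ hξ, hV η hη] at h2
    calc ‖vectorFunctional ξ (η - ξ)‖ ^ 2 ≤ ‖η - ξ‖ ^ 2 := by gcongr
      _ = 2 - 2 * (inner ℂ η ξ : ℂ).re := by
        rw [h2]
        change 1 ^ 2 - 2 * (inner ℂ η ξ : ℂ).re + 1 ^ 2 = _
        ring
  · rintro ψ₁ ⟨ψ₁', h₁', h₁⟩ ψ₂ ⟨ψ₂', h₂', h₂⟩ a b ha hb hab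
    refine ⟨a • ψ₁' + b • ψ₂', convex_convexHull ℝ _ h₁' h₂' ha hb hab, ?_⟩
    have hn : ‖a • ψ₁ + b • ψ₂ - (a • ψ₁' + b • ψ₂')‖ ≤ a * ‖ψ₁ - ψ₁'‖ + b * ‖ψ₂ - ψ₂'‖ := by
      have e : a • ψ₁ + b • ψ₂ - (a • ψ₁' + b • ψ₂') = a • (ψ₁ - ψ₁') + b • (ψ₂ - ψ₂') := by
        rw [smul_sub, smul_sub]; abel
      rw [e]
      refine (norm_add_le _ _).trans_eq ?_
      rw [norm_smul, norm_smul, Real.norm_of_nonneg ha, Real.norm_of_nonneg hb]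
    have hre : ((a • ψ₁ + b • ψ₂) 1).re = a * (ψ₁ 1).re + b * (ψ₂ 1).re := by simp
    -- The squared error is convex while the bound `2 - 2 Re ψ(1)` is affine in `ψ`, so the estimate
    -- survives averaging.
    have hsq : (a * ‖ψ₁ - ψ₁'‖ + b * ‖ψ₂ - ψ₂'‖) ^ 2 ≤
        a * ‖ψ₁ - ψ₁'‖ ^ 2 + b * ‖ψ₂ - ψ₂'‖ ^ 2 := by
      simpa using (convexOn_pow 2).2 (norm_nonneg (ψ₁ - ψ₁')) (norm_nonneg (ψ₂ - ψ₂')) ha hb hab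
    rw [hre]
    calc _ ≤ (a * ‖ψ₁ - ψ₁'‖ + b * ‖ψ₂ - ψ₂'‖) ^ 2 := by gcongr
      _ ≤ a * (2 - 2 * (ψ₁ 1).re) + b * (2 - 2 * (ψ₂ 1).re) := hsq.trans (by gcongr)
      _ = (a + b) * 2 - 2 * (a * (ψ₁ 1).re + b * (ψ₂ 1).re) := by ring
      _ = _ := by rw [hab, one_mul]

/-- Convex combinations converging to `φ` have values at the identity tending to one, so their
distance to suitable separable combinations tends to zero. -/
theorem mem_separableHull_of_mem_vectorHull {V : Set E} (hV : ∀ ξ ∈ V, ‖ξ‖ = 1)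
    {φ : StrongDual ℂ (E →L[ℂ] E)} (hφ : φ ∈ vectorHull V) (hφ1 : φ 1 = 1) :
    φ ∈ separableHull V := by
  obtain ⟨ψ, hψ, hlim⟩ := mem_closure_iff_seq_limit.1 hφ
  choose ψ' hψ' hle using fun n => exists_mem_convexHull_norm_sub_sq_le hV (hψ n)
  refine mem_closure_of_tendsto (f := ψ') (b := Filter.atTop) ?_ (Filter.Eventually.of_forall hψ')
  have hval : Filter.Tendsto (fun n => 2 - 2 * (ψ n 1).re) Filter.atTop (nhds 0) := by
    have h1 : Filter.Tendsto (fun n => (ψ n 1).re) Filter.atTop (nhds 1) := by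
      have := ((Complex.continuous_re.comp
        (ContinuousLinearMap.apply ℂ ℂ (1 : E →L[ℂ] E)).continuous).tendsto φ).comp hlim
      simpa [Function.comp_def, hφ1] using this
    simpa using (tendsto_const_nhds (x := (2 : ℝ))).sub (h1.const_mul 2)
  have hdiff : Filter.Tendsto (fun n => ψ n - ψ' n) Filter.atTop (nhds 0) := by
    rw [tendsto_zero_iff_norm_tendsto_zero]
    have hs := squeeze_zero (fun n => sq_nonneg ‖ψ n - ψ' n‖) hle hval
    have := (Real.continuous_sqrt.tendsto 0).comp hs
    simpa [Function.comp_def, Real.sqrt_sq] using this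
  simpa using hlim.sub hdiff

/-! ### Normal states -/

variable [CompleteSpace E]

/-- A positive functional of norm one on `B(E)` is unital. -/
theorem IsNormalState.map_one {φ : StrongDual ℂ (E →L[ℂ] E)} (hφ : IsNormalState φ) :
    φ 1 = 1 := by
  -- In the GNS space `φ(x) = ⟪[1], [x]⟫` with `‖[1]‖² = φ(1)` and `‖[x]‖ ≤ ‖x‖ ‖[1]‖`.
  -- Cauchy–Schwarz then gives `‖φ‖ ≤ φ(1)`.
  let f : (E →L[ℂ] E) →ₚ[ℂ] ℂ := PositiveLinearMap.mk₀ φ.toLinearMap fun x hx =>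
    hφ.nonneg x ((ContinuousLinearMap.nonneg_iff_isPositive x).1 hx)
  have hf : ∀ x, f x = φ x := fun _ => rfl
  have h0 : 0 ≤ φ 1 := hφ.nonneg 1 ContinuousLinearMap.isPositive_one
  have hsq : ‖f.toPreGNS 1‖ ^ 2 = (φ 1).re := by
    have h := f.preGNS_norm_sq (f.toPreGNS 1)
    rw [f.ofPreGNS_toPreGNS, star_one, one_mul, hf] at h
    rw [← h, ← Complex.ofReal_pow, Complex.ofReal_re]
  have hbound : ∀ x, ‖φ x‖ ≤ (φ 1).re * ‖x‖ := by
    intro x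
    have h1 : (inner ℂ (f.toPreGNS 1) (f.toPreGNS x) : ℂ) = φ x := by
      rw [f.preGNS_inner_def, f.ofPreGNS_toPreGNS, f.ofPreGNS_toPreGNS, star_one, one_mul, hf]
    have h2 : ‖f.toPreGNS x‖ ≤ ‖x‖ * ‖f.toPreGNS 1‖ := by
      have h3 : f.leftMulMapPreGNS x (f.toPreGNS 1) = f.toPreGNS x := by simp
      rw [← h3]
      refine ContinuousLinearMap.le_of_opNorm_le _ ?_ _
      exact LinearMap.mkContinuous_norm_le _ (norm_nonneg _) _
    calc ‖φ x‖ ≤ ‖f.toPreGNS 1‖ * ‖f.toPreGNS x‖ := h1 ▸ norm_inner_le_norm _ _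
      _ ≤ ‖f.toPreGNS 1‖ * (‖x‖ * ‖f.toPreGNS 1‖) := by gcongr
      _ = (φ 1).re * ‖x‖ := by rw [← hsq]; ring
  have hle : 1 ≤ (φ 1).re := by
    rw [← hφ.norm_eq_one]
    exact ContinuousLinearMap.opNorm_le_bound _ (Complex.le_def.1 h0).1 hbound
  have hge : (φ 1).re ≤ 1 := by
    have h1 : ‖(1 : E →L[ℂ] E)‖ ≤ 1 := ContinuousLinearMap.norm_id_le
    calc (φ 1).re ≤ ‖φ 1‖ := Complex.re_le_norm _
      _ ≤ ‖φ‖ * ‖(1 : E →L[ℂ] E)‖ := φ.le_opNorm 1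
      _ ≤ 1 := by rw [hφ.norm_eq_one, one_mul]; exact h1
  exact Complex.ext (le_antisymm hge hle) (Complex.le_def.1 h0).2.symm

theorem IsNormalState.ne_zero {φ : StrongDual ℂ (E →L[ℂ] E)} (hφ : IsNormalState φ) : φ ≠ 0 := by
  rintro rfl
  simpa using hφ.norm_eq_one

theorem minkowski_vectorHull_eq_one_iff {V : Set E} (hV : ∀ ξ ∈ V, ‖ξ‖ = 1)
    {φ : StrongDual ℂ (E →L[ℂ] E)} (hφ : IsNormalState φ) :
    minkowski (vectorHull V) φ = 1 ↔ φ ∈ separableHull V := by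
  constructor
  · exact fun h => mem_separableHull_of_mem_vectorHull hV
      (mem_of_minkowski_eq_one (isClosed_vectorHull V) h) hφ.map_one
  · refine fun h => le_antisymm ?_ (one_le_minkowski_vectorHull hV hφ.norm_eq_one)
    exact iInf₂_le_of_le 1 ⟨φ, separableHull_subset_vectorHull V h, by simp⟩ (by simp)

end Hulls

/-! ### Product vectors and antisymmetric products -/

section Wedge

set_option maxSynthPendingDepth 3

variable {H : Type*} [NormedAddCommGroup H] [InnerProductSpace ℂ H] {k : ℕ}

theorem inner_productVector (f g : Fin k → H) :
    inner ℂ (productVector f) (productVector g) = ∏ i, inner ℂ (f i) (g i) := by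
  rw [productVector, productVector, UniformSpace.Completion.inner_coe,
    AlgTensorPower.inner_tprod_tprod]

theorem norm_productVector (f : Fin k → H) : ‖productVector f‖ = ∏ i, ‖f i‖ := by
  rw [← sq_eq_sq₀ (norm_nonneg _) (Finset.prod_nonneg fun i _ => norm_nonneg _)]
  have h : ((‖productVector f‖ ^ 2 : ℝ) : ℂ) = ((∏ i, ‖f i‖) ^ 2 : ℝ) := by
    have h1 := inner_productVector f f
    simp only [inner_self_eq_norm_sq_to_K] at h1
    rw [← Finset.prod_pow]
    exact_mod_cast h1
  exact_mod_cast h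

theorem norm_eq_one_of_mem_bosonicProductVectors {ξ : bosonicSpace H k}
    (hξ : ξ ∈ bosonicProductVectors H k) : ‖ξ‖ = 1 := by
  obtain ⟨η, hη, h⟩ := hξ
  rw [Submodule.coe_norm, h, norm_productVector]
  simp [hη]

variable (H k) in
/-- The product vector as a multilinear map. -/
noncomputable def productVectorMap :
    MultilinearMap ℂ (fun _ : Fin k => H) (HilbertTensorPower H k) :=
  (UniformSpace.Completion.toComplL (𝕜 := ℂ)
    (E := AlgTensorPower H k)).toLinearMap.compMultilinearMap AlgTensorPower.tprod

theorem productVectorMap_apply (η : Fin k → H) : productVectorMap H k η = productVector η := rfl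

variable (H k) in
/-- The antisymmetric product as an alternating map. -/
noncomputable def wedgeMap : H [⋀^Fin k]→ₗ[ℂ] HilbertTensorPower H k :=
  (((Real.sqrt k.factorial : ℝ) : ℂ)⁻¹) • (productVectorMap H k).alternatization

theorem sqrt_factorial_ne_zero (k : ℕ) : ((Real.sqrt k.factorial : ℝ) : ℂ) ≠ 0 := by
  have : 0 < Real.sqrt k.factorial := Real.sqrt_pos.2 (by positivity)
  exact_mod_cast this.ne'

theorem sqrt_factorial_mul_self (k : ℕ) :
    ((Real.sqrt k.factorial : ℝ) : ℂ) * ((Real.sqrt k.factorial : ℝ) : ℂ) = k.factorial := by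
  rw [← Complex.ofReal_mul, Real.mul_self_sqrt (by positivity)]
  simp

theorem antisymProj_productVector (η : Fin k → H) :
    antisymProj H k (productVector η) = ((k.factorial : ℂ)⁻¹) •
      ∑ π : Equiv.Perm (Fin k), ((Equiv.Perm.sign π : ℤ) : ℂ) •
        productVector fun i => η (π.symm i) := by
  simp [antisymProj, permOp_productVector, sum_apply]

theorem wedge_eq_sum (η : Fin k → H) :
    wedge η = (((Real.sqrt k.factorial : ℝ) : ℂ)⁻¹) •
      ∑ π : Equiv.Perm (Fin k), ((Equiv.Perm.sign π : ℤ) : ℂ) •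
        productVector fun i => η (π.symm i) := by
  rw [wedge, antisymProj_productVector, smul_smul]
  congr 1
  have := sqrt_factorial_ne_zero k
  rw [← sqrt_factorial_mul_self, mul_inv, ← mul_assoc, mul_inv_cancel₀ this, one_mul]

theorem wedgeMap_apply (η : Fin k → H) : wedgeMap H k η = wedge η := by
  rw [wedge_eq_sum, wedgeMap, AlternatingMap.smul_apply, MultilinearMap.alternatization_apply]
  congr 1
  -- Alternatization sums over `η ∘ π`, the wedge over `η ∘ π⁻¹`; inversion preserves signs.
  rw [← Equiv.sum_comp (Equiv.inv (Equiv.Perm (Fin k)))]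
  refine Finset.sum_congr rfl fun π _ => ?_
  simp only [Equiv.inv_apply, Equiv.Perm.sign_inv, MultilinearMap.domDomCongr_apply,
    productVectorMap_apply, Units.smul_def, ← Int.cast_smul_eq_zsmul ℂ]
  rfl

theorem antisymProj_productVector_eq_smul_wedge (η : Fin k → H) :
    antisymProj H k (productVector η) = (((Real.sqrt k.factorial : ℝ) : ℂ)⁻¹) • wedge η := by
  rw [wedge, smul_smul, inv_mul_cancel₀ (sqrt_factorial_ne_zero k), one_smul]

/-! ### Unitarity of the permutation operators and symmetry of `P₋` -/

theorem inner_permOp_permOp (π : Equiv.Perm (Fin k)) (x y : HilbertTensorPower H k) :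
    inner ℂ (permOp H π x) (permOp H π y) = inner ℂ x y := by
  induction x, y using UniformSpace.Completion.induction_on₂ with
  | hp => exact isClosed_eq (by fun_prop) (by fun_prop)
  | ih x y =>
    rw [permOp, ContinuousLinearMap.completion_apply_coe, ContinuousLinearMap.completion_apply_coe,
      UniformSpace.Completion.inner_coe, UniformSpace.Completion.inner_coe]
    exact AlgTensorPower.inner_perm_perm π x y

theorem permOp_one : permOp H (1 : Equiv.Perm (Fin k)) = 1 := by
  refine ContinuousLinearMap.ext fun x => ?_
  induction x using UniformSpace.Completion.induction_on with
  | hp => exact isClosed_eq (ContinuousLinearMap.continuous _) (ContinuousLinearMap.continuous _)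
  | ih x =>
    induction x using AlgTensorPower.induction_tprod with
    | h c f =>
      rw [UniformSpace.Completion.coe_smul, map_smul, map_smul]
      exact congrArg (c • ·) (permOp_productVector 1 f)
    | ha x y hx hy => rw [UniformSpace.Completion.coe_add, map_add, map_add, hx, hy]

theorem inner_permOp_left (π : Equiv.Perm (Fin k)) (x y : HilbertTensorPower H k) :
    inner ℂ (permOp H π x) y = inner ℂ x (permOp H π⁻¹ y) := by
  have h : permOp H π (permOp H π⁻¹ y) = y := by
    rw [← mul_apply_eq_comp, ← permOp_mul, mul_inv_cancel, permOp_one]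
    rfl
  rw [← inner_permOp_permOp π x, h]

/-- `P₋` is symmetric. -/
theorem inner_antisymProj_left (x y : HilbertTensorPower H k) :
    inner ℂ (antisymProj H k x) y = inner ℂ x (antisymProj H k y) := by
  simp only [antisymProj, smul_apply, sum_apply, inner_smul_left, inner_smul_right,
    sum_inner, inner_sum, inner_permOp_left]
  rw [← Equiv.sum_comp (Equiv.inv (Equiv.Perm (Fin k)))]
  simp

theorem antisymProj_apply_coe (x : fermionicSpace H k) : antisymProj H k x = x := by
  obtain ⟨_, y, rfl⟩ := x
  exact congrArg (fun T : HilbertTensorPower H k →L[ℂ] HilbertTensorPower H k => T y)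
    antisymProj_idem

/-- A nontrivial permutation makes the product vector orthogonal to the original one. Only the
identity term of `P₋` contributes, and its weight `1/k!` cancels the squared normalisation. -/
theorem norm_wedge_of_orthonormal {e : Fin k → H} (he : Orthonormal ℂ e) : ‖wedge e‖ = 1 := by
  have hin : ∀ π : Equiv.Perm (Fin k),
      (inner ℂ (productVector e) (productVector fun i => e (π.symm i)) : ℂ) =
        if π = 1 then 1 else 0 := by
    intro π
    rw [inner_productVector]
    split_ifs with h
    · subst h
      refine Finset.prod_eq_one fun i _ => ?_
      change (inner ℂ (e i) (e i) : ℂ) = 1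
      rw [orthonormal_iff_ite.1 he, if_pos rfl]
    · obtain ⟨i, hi⟩ : ∃ i, π.symm i ≠ i := by
        by_contra! hc
        refine h (Equiv.ext fun i => ?_)
        conv_lhs => rw [← hc i]
        simp
      exact Finset.prod_eq_zero (Finset.mem_univ i) (he.2 hi.symm)
  have h : (inner ℂ (wedge e) (wedge e) : ℂ) = 1 := by
    have hP : antisymProj H k (antisymProj H k (productVector e)) =
        antisymProj H k (productVector e) :=
      antisymProj_apply_coe ⟨_, productVector e, rfl⟩
    rw [wedge, inner_smul_left, inner_smul_right, Complex.conj_ofReal, ← mul_assoc,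
      sqrt_factorial_mul_self, inner_antisymProj_left, hP, antisymProj_productVector,
      inner_smul_right, ← mul_assoc, mul_inv_cancel₀ (by positivity), one_mul, inner_sum]
    simp [hin]
  rw [norm_eq_sqrt_re_inner (𝕜 := ℂ), h]
  simp

/-- A nonzero antisymmetric product is a multiple of one of orthonormal vectors, the factor being
bounded as in Hadamard's inequality. -/
theorem exists_orthonormal_wedge_eq_smul {η : Fin k → H} (h : wedge η ≠ 0) :
    ∃ e : Fin k → H, Orthonormal ℂ e ∧ ∃ c : ℂ, ‖c‖ ≤ ∏ i, ‖η i‖ ∧ wedge η = c • wedge e := by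
  have hli : LinearIndependent ℂ η := by
    by_contra hc
    exact h (wedgeMap_apply η ▸ (wedgeMap H k).map_linearDependent η hc)
  let S := Submodule.span ℂ (Set.range η)
  have hS : Module.finrank ℂ S = Fintype.card (Fin k) := finrank_span_eq_card hli
  have : FiniteDimensional ℂ S := FiniteDimensional.span_of_finite ℂ (Set.finite_range η)
  let v : Fin k → S := fun i => ⟨η i, Submodule.subset_span ⟨i, rfl⟩⟩
  -- The matrix of `v` in its Gram–Schmidt basis is triangular, so its determinant is the product of
  -- the diagonal entries `⟪b i, v i⟫`, each bounded by `‖η i‖`.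
  let b := InnerProductSpace.gramSchmidtOrthonormalBasis hS v
  have hdet : b.toBasis.det v = ∏ i, inner ℂ (b i) (v i) :=
    InnerProductSpace.gramSchmidtOrthonormalBasis_det hS v
  refine ⟨fun i => b i, b.orthonormal.comp_linearIsometry S.subtypeₗᵢ, b.toBasis.det v, ?_, ?_⟩
  · rw [hdet, norm_prod]
    refine Finset.prod_le_prod (fun i _ => norm_nonneg _) fun i _ => ?_
    refine (norm_inner_le_norm _ _).trans ?_
    rw [b.orthonormal.1 i, one_mul]
    rfl
  · let f : S [⋀^Fin k]→ₗ[ℂ] HilbertTensorPower H k := (wedgeMap H k).compLinearMap S.subtype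
    -- Alternating `k`-linear maps on a `k`-dimensional space are determined by their value on one
    -- basis, hence are multiples of its determinant.
    have hext : f = (LinearMap.toSpanSingleton ℂ _ (f b.toBasis)).compAlternatingMap
        b.toBasis.det := by
      refine Module.Basis.ext_alternating b.toBasis fun i hi => ?_
      let σ : Equiv.Perm (Fin k) := Equiv.ofBijective i (Finite.injective_iff_bijective.1 hi)
      change f (b.toBasis ∘ σ) =
        (LinearMap.toSpanSingleton ℂ _ (f b.toBasis)).compAlternatingMap b.toBasis.det
          (b.toBasis ∘ σ)
      rw [AlternatingMap.map_perm, AlternatingMap.map_perm]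
      rw [LinearMap.compAlternatingMap_apply, b.toBasis.det_self, LinearMap.toSpanSingleton_apply,
        one_smul]
    have := congrArg (fun g => g v) hext
    simpa [f, v, wedgeMap_apply, Function.comp_def] using this

/-- Contractivity of `P₋` alone would leave an extra factor `√k!`; Hadamard's inequality removes it.
-/
theorem norm_wedge_le (η : Fin k → H) : ‖wedge η‖ ≤ ∏ i, ‖η i‖ := by
  by_cases h : wedge η = 0
  · rw [h, norm_zero]
    exact Finset.prod_nonneg fun i _ => norm_nonneg _
  · obtain ⟨e, he, c, hc, hw⟩ := exists_orthonormal_wedge_eq_smul h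
    rwa [hw, norm_smul, norm_wedge_of_orthonormal he, mul_one]

theorem norm_wedge_zero (η : Fin 0 → H) : ‖wedge η‖ = 1 :=
  norm_wedge_of_orthonormal ⟨fun i => i.elim0, fun i => i.elim0⟩

/-- Absorbing a scalar into a factor requires at least one factor, which is why `k = 0` is treated
separately below. -/
theorem wedge_update_smul [NeZero k] (c : ℂ) (η : Fin k → H) :
    wedge (Function.update η 0 (c • η 0)) = c • wedge η := by
  rw [← wedgeMap_apply, AlternatingMap.map_update_smul, Function.update_eq_self, wedgeMap_apply]

theorem productVector_update_smul [NeZero k] (c : ℂ) (η : Fin k → H) :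
    productVector (Function.update η 0 (c • η 0)) = c • productVector η := by
  rw [← productVectorMap_apply, MultilinearMap.map_update_smul, Function.update_eq_self,
    productVectorMap_apply]

theorem norm_update_smul [NeZero k] {c : ℂ} (hc : ‖c‖ = 1) {η : Fin k → H} (hη : ∀ i, ‖η i‖ = 1)
    (i : Fin k) : ‖Function.update η 0 (c • η 0) i‖ = 1 := by
  by_cases hi : i = 0
  · subst hi
    simp [norm_smul, hc, hη]
  · simp [Function.update_of_ne hi, hη]

theorem sign_smul_productVector_mem (π : Equiv.Perm (Fin k)) {η : Fin k → H}
    (hη : ∀ i, ‖η i‖ = 1) :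
    ((Equiv.Perm.sign π : ℤ) : ℂ) • productVector η ∈ productVectors H k := by
  rcases Nat.eq_zero_or_pos k with rfl | hk
  · rw [Subsingleton.elim π 1]
    exact ⟨η, hη, by simp⟩
  · have : NeZero k := ⟨hk.ne'⟩
    refine ⟨_, norm_update_smul ?_ hη, (productVector_update_smul _ η).symm⟩
    rcases Int.units_eq_one_or (Equiv.Perm.sign π) with h | h <;> simp [h]

variable (H k) in
/-- The antisymmetric product as an element of `H^{∧k}`. -/
noncomputable def fermionicWedge (η : Fin k → H) : fermionicSpace H k :=
  ⟨wedge η, (fermionicSpace H k).smul_mem _ ⟨productVector η, rfl⟩⟩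

theorem fermionicWedge_mem {η : Fin k → H} (h : ‖wedge η‖ = 1) :
    fermionicWedge H k η ∈ fermionicProductVectors H k :=
  ⟨h, η, rfl⟩

theorem antisymProjRestrict_productVector (η : Fin k → H) :
    antisymProjRestrict H k (productVector η) =
      (((Real.sqrt k.factorial : ℝ) : ℂ)⁻¹) • fermionicWedge H k η :=
  Subtype.ext (antisymProj_productVector_eq_smul_wedge η)

/-- A unit antisymmetric product is one of unit vectors. -/
theorem exists_unit_vectors_of_mem_fermionicProductVectors {ξ : fermionicSpace H k}
    (hξ : ξ ∈ fermionicProductVectors H k) :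
    ∃ e : Fin k → H, (∀ i, ‖e i‖ = 1) ∧ (ξ : HilbertTensorPower H k) = wedge e := by
  obtain ⟨h1, η, hη⟩ := hξ
  rw [Submodule.coe_norm, hη] at h1
  rcases Nat.eq_zero_or_pos k with rfl | hk
  · exact ⟨η, fun i => i.elim0, hη⟩
  · have : NeZero k := ⟨hk.ne'⟩
    -- The given factors may have any norms. Passing to orthonormal ones leaves only a phase `c`,
    -- absorbed into the first factor.
    obtain ⟨e, he, c, -, hw⟩ := exists_orthonormal_wedge_eq_smul (η := η) fun h0 => by
      rw [h0, norm_zero] at h1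
      exact zero_ne_one h1
    have hc : ‖c‖ = 1 := by
      rwa [hw, norm_smul, norm_wedge_of_orthonormal he, mul_one] at h1
    exact ⟨_, norm_update_smul hc he.1, by rw [hη, hw, wedge_update_smul]⟩

theorem exists_mem_fermionicProductVectors_smul {η : Fin k → H} (h : wedge η ≠ 0) :
    ∃ ζ ∈ fermionicProductVectors H k, fermionicWedge H k η = ((‖wedge η‖ : ℝ) : ℂ) • ζ := by
  rcases Nat.eq_zero_or_pos k with rfl | hk
  · exact ⟨_, fermionicWedge_mem (norm_wedge_zero η), by simp [norm_wedge_zero η]⟩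
  · have : NeZero k := ⟨hk.ne'⟩
    have hn : ‖wedge η‖ ≠ 0 := norm_ne_zero_iff.2 h
    have hn' : ((‖wedge η‖ : ℝ) : ℂ) ≠ 0 := by exact_mod_cast hn
    have hw := wedge_update_smul (((‖wedge η‖ : ℝ) : ℂ)⁻¹) η
    refine ⟨fermionicWedge H k (Function.update η 0 ((((‖wedge η‖ : ℝ) : ℂ)⁻¹) • η 0)),
      fermionicWedge_mem ?_, Subtype.ext ?_⟩
    · rw [hw, norm_smul, norm_inv, Complex.norm_real, norm_norm, inv_mul_cancel₀ hn]
    · change wedge η = ((‖wedge η‖ : ℝ) : ℂ) • wedge (Function.update η 0 _)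
      rw [hw, smul_smul, mul_inv_cancel₀ hn', one_smul]

end Wedge

/-! ### Comparison of the hulls on `H^{∧k}` and on `H^{⊗k}` -/

section Comparison

set_option maxSynthPendingDepth 3

variable {H : Type*} [NormedAddCommGroup H] [InnerProductSpace ℂ H] {k : ℕ}

theorem viewOnTensorPower_vectorFunctional (ξ η : fermionicSpace H k) :
    viewOnTensorPower (vectorFunctional ξ η) =
      vectorFunctional (ξ : HilbertTensorPower H k) (η : HilbertTensorPower H k) := by
  ext x
  change inner ℂ (η : HilbertTensorPower H k) (antisymProj H k (x ξ)) = inner ℂ _ (x ξ)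
  rw [← inner_antisymProj_left, antisymProj_apply_coe]

/-- The two normalisations `1/√k!` contribute one factor `1/k!`; the prefactor supplies the second,
turning the sum over pairs of permutations into an average. -/
theorem inv_factorial_smul_vectorFunctional_wedge_mem {e f : Fin k → H} (he : ∀ i, ‖e i‖ = 1)
    (hf : ∀ i, ‖f i‖ = 1) :
    ((k.factorial : ℂ)⁻¹) • vectorFunctional (wedge e) (wedge f) ∈
      vectorHull (productVectors H k) := by
  let u (g : Fin k → H) (π : Equiv.Perm (Fin k)) : HilbertTensorPower H k :=
    ((Equiv.Perm.sign π : ℤ) : ℂ) • productVector fun i => g (π.symm i)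
  have hu : ∀ {g : Fin k → H}, (∀ i, ‖g i‖ = 1) → ∀ π, u g π ∈ productVectors H k :=
    fun hg π => sign_smul_productVector_mem π fun i => hg (π.symm i)
  have h := vectorFunctional_sum_mem_vectorHull (hu he) (hu hf)
  rw [Fintype.card_perm, Fintype.card_fin, ← smul_smul] at h
  rw [wedge_eq_sum, wedge_eq_sum, vectorFunctional_smul_smul, star_inv₀, Complex.star_def,
    Complex.conj_ofReal, ← mul_inv, sqrt_factorial_mul_self]
  exact h

/-- The functional `x ↦ φ(P₋ x P₋)` belongs to `k! K^{⊗k}` if `φ` belongs to `K^{∧k}`. -/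
theorem inv_factorial_smul_viewOnTensorPower_mem
    {κ : StrongDual ℂ (fermionicSpace H k →L[ℂ] fermionicSpace H k)}
    (hκ : κ ∈ vectorHull (fermionicProductVectors H k)) :
    ((k.factorial : ℂ)⁻¹) • viewOnTensorPower κ ∈ vectorHull (productVectors H k) := by
  refine comp_vectorHull (compress H k) _ (convex_vectorHull _) (isClosed_vectorHull _)
    (fun ξ hξ η hη => ?_) hκ
  obtain ⟨e, he, hξe⟩ := exists_unit_vectors_of_mem_fermionicProductVectors hξ
  obtain ⟨f, hf, hηf⟩ := exists_unit_vectors_of_mem_fermionicProductVectors hη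
  change ((k.factorial : ℂ)⁻¹) • viewOnTensorPower (vectorFunctional ξ η) ∈ _
  rw [viewOnTensorPower_vectorFunctional, hξe, hηf]
  exact inv_factorial_smul_vectorFunctional_wedge_mem he hf

/-! ### Restriction from `B(H^{⊗k})` to `B(H^{∧k})` -/

variable (H k) in
/-- The embedding `x ↦ x P₋` of `B(H^{∧k})` into `B(H^{⊗k})`. -/
noncomputable def extendOp : (fermionicSpace H k →L[ℂ] fermionicSpace H k) →L[ℂ]
    (HilbertTensorPower H k →L[ℂ] HilbertTensorPower H k) :=
  ((fermionicSpace H k).subtypeL.postcomp (HilbertTensorPower H k)).comp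
    ((antisymProjRestrict H k).precomp (fermionicSpace H k))

/-- Compressing `x P₋` returns `x`, because `P₋` is the identity on `H^{∧k}`. A decomposition on
`H^{⊗k}` can thus be pulled back to one of `φ`. -/
theorem viewOnTensorPower_comp_extendOp
    (φ : StrongDual ℂ (fermionicSpace H k →L[ℂ] fermionicSpace H k)) :
    (viewOnTensorPower φ).comp (extendOp H k) = φ := by
  refine ContinuousLinearMap.ext fun x => ?_
  change φ (compress H k (extendOp H k x)) = φ x
  congr 1
  refine ContinuousLinearMap.ext fun ξ => Subtype.ext ?_
  change antisymProj H k (x (antisymProjRestrict H k ξ)) = x ξ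
  have hξ : antisymProjRestrict H k ξ = ξ := Subtype.ext (antisymProj_apply_coe ξ)
  rw [antisymProj_apply_coe, hξ]

theorem vectorFunctional_comp_extendOp (ξ η : HilbertTensorPower H k) :
    (vectorFunctional ξ η).comp (extendOp H k) =
      vectorFunctional (antisymProjRestrict H k ξ) (antisymProjRestrict H k η) := by
  refine ContinuousLinearMap.ext fun x => ?_
  change inner ℂ η ((x (antisymProjRestrict H k ξ) : fermionicSpace H k) : HilbertTensorPower H k) =
    inner ℂ (antisymProj H k η) (x (antisymProjRestrict H k ξ) : HilbertTensorPower H k)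
  rw [inner_antisymProj_left, antisymProj_apply_coe]

theorem factorial_smul_vectorFunctional_productVector_comp_extendOp (e f : Fin k → H) :
    (k.factorial : ℂ) • (vectorFunctional (productVector e) (productVector f)).comp (extendOp H k) =
      vectorFunctional (fermionicWedge H k e) (fermionicWedge H k f) := by
  have hk : (k.factorial : ℂ) ≠ 0 := by positivity
  rw [vectorFunctional_comp_extendOp, antisymProjRestrict_productVector,
    antisymProjRestrict_productVector, vectorFunctional_smul_smul, smul_smul, star_inv₀,
    Complex.star_def, Complex.conj_ofReal, ← mul_inv, sqrt_factorial_mul_self, mul_inv_cancel₀ hk,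
    one_smul]

/-- For positive `k` a sign can be absorbed into a factor. For `k = 0` there is a single wedge, and
its hull is one nonzero functional. -/
theorem zero_mem_vectorHull_fermionicProductVectors [NeZero k]
    (h : (fermionicProductVectors H k).Nonempty) :
    0 ∈ vectorHull (fermionicProductVectors H k) := by
  obtain ⟨ζ, hζ⟩ := h
  refine zero_mem_vectorHull hζ ?_
  obtain ⟨h1, η, hη⟩ := hζ
  refine ⟨by rw [norm_neg, h1], Function.update η 0 ((-1 : ℂ) • η 0), ?_⟩
  rw [wedge_update_smul, ← hη, neg_one_smul]
  rfl

/-- Wedges of unit vectors may be shorter than one or vanish. Since the hull is convex and, for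
positive `k`, contains zero, shrinking does not leave it. -/
theorem vectorFunctional_fermionicWedge_mem (h : (fermionicProductVectors H k).Nonempty)
    {e f : Fin k → H} (he : ∀ i, ‖e i‖ = 1) (hf : ∀ i, ‖f i‖ = 1) :
    vectorFunctional (fermionicWedge H k e) (fermionicWedge H k f) ∈
      vectorHull (fermionicProductVectors H k) := by
  rcases Nat.eq_zero_or_pos k with rfl | hk
  · exact vectorFunctional_mem_vectorHull (fermionicWedge_mem (norm_wedge_zero e))
      (fermionicWedge_mem (norm_wedge_zero f))
  have : NeZero k := ⟨hk.ne'⟩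
  have h0 := zero_mem_vectorHull_fermionicProductVectors h
  by_cases hwe : wedge e = 0
  · have : fermionicWedge H k e = 0 := Subtype.ext hwe
    rwa [this, zero_vectorFunctional]
  by_cases hwf : wedge f = 0
  · have : fermionicWedge H k f = 0 := Subtype.ext hwf
    rwa [this, vectorFunctional_zero]
  obtain ⟨ξ, hξ, hξe⟩ := exists_mem_fermionicProductVectors_smul hwe
  obtain ⟨η, hη, hηf⟩ := exists_mem_fermionicProductVectors_smul hwf
  have hle : ∀ {g : Fin k → H}, (∀ i, ‖g i‖ = 1) → ‖wedge g‖ ≤ 1 := fun {g} hg => by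
    simpa [hg] using norm_wedge_le g
  rw [hξe, hηf]
  exact vectorFunctional_smul_smul_mem_vectorHull h0 hξ hη ⟨norm_nonneg _, hle he⟩
    ⟨norm_nonneg _, hle hf⟩

theorem factorial_smul_comp_extendOp_mem (h : (fermionicProductVectors H k).Nonempty)
    {κ : StrongDual ℂ (HilbertTensorPower H k →L[ℂ] HilbertTensorPower H k)}
    (hκ : κ ∈ vectorHull (productVectors H k)) :
    (k.factorial : ℂ) • κ.comp (extendOp H k) ∈ vectorHull (fermionicProductVectors H k) := by
  refine comp_vectorHull (extendOp H k) _ (convex_vectorHull _) (isClosed_vectorHull _) ?_ hκ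
  rintro _ ⟨e, he, rfl⟩ _ ⟨f, hf, rfl⟩
  rw [factorial_smul_vectorFunctional_productVector_comp_extendOp]
  exact vectorFunctional_fermionicWedge_mem h he hf

/-- If no antisymmetric product is a unit vector, then `K^{⊗k}` restricts to `0` on
`B(H^{∧k})`. -/
theorem comp_extendOp_eq_zero (h : ¬ (fermionicProductVectors H k).Nonempty)
    {κ : StrongDual ℂ (HilbertTensorPower H k →L[ℂ] HilbertTensorPower H k)}
    (hκ : κ ∈ vectorHull (productVectors H k)) : κ.comp (extendOp H k) = 0 := by
  have hk : (k.factorial : ℂ) ≠ 0 := by positivity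
  have hw : ∀ e : Fin k → H, fermionicWedge H k e = 0 := fun e => by
    by_contra hc
    obtain ⟨ζ, hζ, -⟩ := exists_mem_fermionicProductVectors_smul (η := e)
      fun h0 => hc (Subtype.ext h0)
    exact h ⟨ζ, hζ⟩
  have h0 : (k.factorial : ℂ) • κ.comp (extendOp H k) ∈
      ({0} : Set (StrongDual ℂ (fermionicSpace H k →L[ℂ] fermionicSpace H k))) := by
    refine comp_vectorHull (extendOp H k) _ (convex_singleton 0) isClosed_singleton ?_ hκ
    rintro _ ⟨e, he, rfl⟩ _ ⟨f, hf, rfl⟩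
    rw [factorial_smul_vectorFunctional_productVector_comp_extendOp, hw e, zero_vectorFunctional]
    rfl
  exact (smul_eq_zero.1 (Set.mem_singleton_iff.1 h0)).resolve_left hk

/-- `q_{K^{⊗k}} = k! q_{K^{∧k}}` on nonzero functionals on `B(H^{∧k})`. -/
theorem minkowski_viewOnTensorPower
    {φ : StrongDual ℂ (fermionicSpace H k →L[ℂ] fermionicSpace H k)} (hφ : φ ≠ 0) :
    minkowski (vectorHull (productVectors H k)) (viewOnTensorPower φ) =
      k.factorial * minkowski (vectorHull (fermionicProductVectors H k)) φ := by
  have hk : (k.factorial : ℂ) ≠ 0 := by positivity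
  have hk0 : (k.factorial : ℝ≥0∞) ≠ 0 := by exact_mod_cast k.factorial_ne_zero
  have hktop : (k.factorial : ℝ≥0∞) ≠ ⊤ := ENNReal.natCast_ne_top _
  apply le_antisymm
  · rw [mul_comm, ← ENNReal.div_le_iff_le_mul (Or.inl hk0) (Or.inl hktop)]
    refine le_iInf₂ fun α ⟨κ, hκ, h⟩ => ?_
    rw [ENNReal.div_le_iff_le_mul (Or.inl hk0) (Or.inl hktop), mul_comm]
    -- A decomposition at scale `α` on `H^{∧k}` becomes one at scale `k! α` on `H^{⊗k}`.
    refine iInf₂_le_of_le (k.factorial * α) ⟨_, inv_factorial_smul_viewOnTensorPower_mem hκ, ?_⟩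
      (by push_cast; rfl)
    have : viewOnTensorPower φ = (α : ℂ) • viewOnTensorPower κ := by
      rw [h]; rfl
    rw [this, smul_smul]
    congr 1
    push_cast
    field_simp
  · refine le_iInf₂ fun β ⟨κ, hκ, h⟩ => ?_
    have hφκ : φ = (β : ℂ) • κ.comp (extendOp H k) := by
      rw [← viewOnTensorPower_comp_extendOp φ, h]; rfl
    -- Without unit wedges `K^{∧k}` is empty although `K^{⊗k}` need not be; `φ ≠ 0` excludes this
    -- case.
    have hV : (fermionicProductVectors H k).Nonempty := by
      by_contra hc
      exact hφ (by rw [hφκ, comp_extendOp_eq_zero hc hκ, smul_zero])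
    have hle : minkowski (vectorHull (fermionicProductVectors H k)) φ ≤
        ((β / k.factorial : ℝ≥0) : ℝ≥0∞) := by
      refine iInf₂_le _ ⟨_, factorial_smul_comp_extendOp_mem hV hκ, ?_⟩
      rw [smul_smul]
      conv_lhs => rw [hφκ]
      congr 1
      push_cast
      field_simp
    rw [ENNReal.coe_div (by exact_mod_cast k.factorial_ne_zero), ENNReal.coe_natCast] at hle
    calc _ ≤ (k.factorial : ℝ≥0∞) * (β / k.factorial) := by gcongr
      _ = β := ENNReal.mul_div_cancel hk0 hktop

end Comparison

theorem proposition5 {H : Type*} [NormedAddCommGroup H] [InnerProductSpace ℂ H] [CompleteSpace H]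
    (k : ℕ) :
    (∀ φ : StrongDual ℂ (bosonicSpace H k →L[ℂ] bosonicSpace H k), IsNormalState φ →
      1 ≤ minkowski (vectorHull (bosonicProductVectors H k)) φ ∧
      (minkowski (vectorHull (bosonicProductVectors H k)) φ = 1 ↔ IsBosonicSeparable φ)) ∧
    (∀ φ : StrongDual ℂ (fermionicSpace H k →L[ℂ] fermionicSpace H k), IsNormalState φ →
      1 ≤ minkowski (vectorHull (fermionicProductVectors H k)) φ ∧
      (minkowski (vectorHull (fermionicProductVectors H k)) φ = 1 ↔ IsFermionicSeparable φ) ∧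
      minkowski (vectorHull (fermionicProductVectors H k)) φ =
        (k.factorial : ℝ≥0∞)⁻¹ *
          minkowski (vectorHull (productVectors H k)) (viewOnTensorPower φ) ∧
      (k.factorial : ℝ≥0∞) ≤
        minkowski (vectorHull (productVectors H k)) (viewOnTensorPower φ) ∧
      (minkowski (vectorHull (productVectors H k)) (viewOnTensorPower φ) = k.factorial ↔
        IsFermionicSeparable φ)) := by
  refine ⟨fun φ hφ => ?_, fun φ hφ => ?_⟩
  · have hV : ∀ ξ ∈ bosonicProductVectors H k, ‖ξ‖ = 1 :=
      fun ξ hξ => norm_eq_one_of_mem_bosonicProductVectors hξ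
    exact ⟨one_le_minkowski_vectorHull hV hφ.norm_eq_one, minkowski_vectorHull_eq_one_iff hV hφ⟩
  · have hV : ∀ ξ ∈ fermionicProductVectors H k, ‖ξ‖ = 1 := fun ξ hξ => hξ.1
    have h1 := one_le_minkowski_vectorHull hV hφ.norm_eq_one
    have hiff := minkowski_vectorHull_eq_one_iff hV hφ
    have hk0 : (k.factorial : ℝ≥0∞) ≠ 0 := by exact_mod_cast k.factorial_ne_zero
    have hktop : (k.factorial : ℝ≥0∞) ≠ ⊤ := ENNReal.natCast_ne_top _
    rw [minkowski_viewOnTensorPower hφ.ne_zero]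
    refine ⟨h1, hiff, ?_, le_mul_of_one_le_right' h1, ?_⟩
    · rw [← mul_assoc, ENNReal.inv_mul_cancel hk0 hktop, one_mul]
    · rw [IsFermionicSeparable, ← hiff]
      simpa only [mul_one] using ENNReal.mul_right_inj (c := 1) hk0 hktop
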